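/- Let $d\in\mathbb N$ and $a<b$ in $\mathbb R$. For a locally Lipschitz function $\phi:\mathbb R^d\to\mathbb R$ let $$\partial^*\phi(x)=\mathrm{Conv}\Big\{\lim_{i\to\infty}\nabla\phi(x_i)\ :\ x_i\to x,\ \phi\text{ differentiable at every }x_i,\ \text{the limit exists}\Big\}$$ denote its Clarke gradient at $x$, and for $A\subset\mathbb R^d$ let $\Delta(A)=\inf\{\|v\| : v\in A\}$, where $\|\cdot\|$ is the Euclidean norm. Let $\phi:\mathbb R^d\to\mathbb R$ be a locally Lipschitz function that is Lipschitz on $\overline{\phi^{-1}(a,b]}$, and let $\mu>0$ be such that $\Delta(\partial^*\phi(x))\ge\mu$ for all $x\in\phi^{-1}(a,b]$ (for instance $\mu=\inf\{\Delta(\partial^*\phi(x)) : x\in\phi^{-1}(a,b]\}$ if this infimum is positive and finite). Then for every $\varepsilon\in(0,\mu)$ there exists a continuous map $$C_\phi:[0,1]\times\phi^{-1}(-\infty,b]\to\phi^{-1}(-\infty,b]$$ such that 1. for all $0\le t<s\le 1$ and all $x\in\phi^{-1}(-\infty,b]$ with $C_\phi(s,x)\in\phi^{-1}(a,b]$, $$\phi(C_\phi(s,x))-\phi(C_\phi(t,x))\le-(s-t)(b-a);$$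 2. $C_\phi(t,x)=x$ for all $t\in[0,1]$ and $x\in\phi^{-1}(-\infty,a]$; 3. for every $x\in\phi^{-1}(-\infty,b]$ the map $s\mapsto C_\phi(s,x)$ is $\frac{b-a}{\mu-\varepsilon}$-Lipschitz on $[0,1]$; 4. $C_\phi$ is a strong deformation retraction of $\phi^{-1}(-\infty,b]$ onto $\phi^{-1}(-\infty,a]$: $C_\phi(0,x)=x$ and $\phi(C_\phi(1,x))\le a$ for all $x\in\phi^{-1}(-\infty,b]$, and $C_\phi(t,x)=x$ for all $t\in[0,1]$ and $x\in\phi^{-1}(-\infty,a]$. In particular, $\phi^{-1}(-\infty,a]$ is a strong deformation retract of $\phi^{-1}(-\infty,b]$. -/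

import Mathlib

open Set Filter Topology

namespace ApproxFlow

/-- The Clarke gradient of `φ` at `x`: the convex hull of all limits of `∇ φ (u n)`, where `u n`
tends to `x` and `φ` is differentiable at every `u n`. -/
noncomputable def clarkeGradient {d : ℕ} (φ : EuclideanSpace ℝ (Fin d) → ℝ)
    (x : EuclideanSpace ℝ (Fin d)) : Set (EuclideanSpace ℝ (Fin d)) :=
  convexHull ℝ {v | ∃ u : ℕ → EuclideanSpace ℝ (Fin d),
    (∀ n, DifferentiableAt ℝ φ (u n)) ∧ Tendsto u atTop (𝓝 x) ∧
      Tendsto (fun n => gradient φ (u n)) atTop (𝓝 v)}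

/-- The distance from the origin to a set, `Δ(A) = inf {‖v‖ : v ∈ A}`. -/
noncomputable def distZero {d : ℕ} (A : Set (EuclideanSpace ℝ (Fin d))) : ℝ :=
  Metric.infDist 0 A

/-- The continuous map `H : [0,1] × X → X` is a strong deformation retraction of `X` onto `A`. -/
structure IsStrongDeformationRetraction {X : Type*} [TopologicalSpace X] (A : Set X)
    (H : C(unitInterval × X, X)) : Prop where
  map_zero : ∀ x, H (0, x) = x
  map_one_mem : ∀ x, H (1, x) ∈ A
  map_fixed : ∀ t, ∀ x ∈ A, H (t, x) = x

end ApproxFlow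

/-!
Near every point of `φ ⁻¹' Ioc a b`, compactness of bounded sets of gradients provides a vector of
norm at most one along which all gradients of `φ` exceed `m = μ - ε`. A countable family of
Lipschitz weights glues these directions to a bounded Lipschitz field `X`. The time-`t` maps of the
flow of `-X` are bi-Lipschitz, so by Rademacher and Fubini almost every trajectory meets the
non-differentiability set of `φ` only in a null set of times. Along such a trajectory the chain rule
shows that `φ` drops by at least `m` times the length travelled, and this closed condition passes
to all trajectories by density.

Hence on the closure of a single trajectory two points are at distance at most `1 / m` times their
difference in level, and `C (t, x)` is the point of that closure whose level is `φ x - t * (b - a)`,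
cut off at `a`. The closure is needed because a trajectory may reach the level `a` only in the
limit.
-/

namespace ApproxFlow

open MeasureTheory Metric NNReal

section DescentLevel

/-- The level reached at time `t` from the level `c` when descending at constant speed `b - a` and
stopping at the level `a`; levels `c ≤ a` are left where they are. -/
def descentLevel (a b t c : ℝ) : ℝ := max (c - t * (b - a)) (min a c)

variable {a b c s t : ℝ}

theorem descentLevel_mem_Icc (hab : a ≤ b) (ht : 0 ≤ t) :
    descentLevel a b t c ∈ Icc (min a c) c :=
  ⟨le_max_right _ _,
    max_le (sub_le_self _ (mul_nonneg ht (sub_nonneg.2 hab))) (min_le_right _ _)⟩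

theorem descentLevel_zero (a b c : ℝ) : descentLevel a b 0 c = c := by
  simp [descentLevel]

theorem descentLevel_one_le (hc : c ≤ b) : descentLevel a b 1 c ≤ a :=
  max_le (by linarith) (min_le_left _ _)

theorem descentLevel_of_le (hab : a ≤ b) (ht : 0 ≤ t) (hc : c ≤ a) : descentLevel a b t c = c := by
  simpa [min_eq_right hc] using descentLevel_mem_Icc (c := c) hab ht

theorem abs_descentLevel_sub_le (hab : a ≤ b) :
    |descentLevel a b s c - descentLevel a b t c| ≤ (b - a) * |s - t| :=
  calc |descentLevel a b s c - descentLevel a b t c|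
      ≤ |(c - s * (b - a)) - (c - t * (b - a))| := abs_max_sub_max_le_abs _ _ _
    _ = (b - a) * |s - t| := by
      rw [sub_sub_sub_cancel_left, ← sub_mul, abs_mul, abs_of_nonneg (sub_nonneg.2 hab),
        abs_sub_comm, mul_comm]

theorem descentLevel_sub_le (hs : a < descentLevel a b s c) :
    descentLevel a b s c - descentLevel a b t c ≤ -(s - t) * (b - a) := by
  have hs' : descentLevel a b s c = c - s * (b - a) :=
    max_eq_left <| (min_le_left _ _).trans
      ((lt_max_iff.1 hs).resolve_right (min_le_left _ _).not_gt).le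
  have ht : c - t * (b - a) ≤ descentLevel a b t c := le_max_left _ _
  linarith

end DescentLevel

section SteepDescent

/-- `φ` decreases along the curve `γ`, at least `m` times as fast as `γ` moves. -/
def IsSteepDescent {X : Type*} [PseudoMetricSpace X] (φ : X → ℝ) (m : ℝ) (γ : ℝ → X) : Prop :=
  ∀ ⦃s t : ℝ⦄, s ≤ t → m * dist (γ s) (γ t) ≤ φ (γ s) - φ (γ t)

namespace IsSteepDescent

variable {X Z : Type*} [PseudoMetricSpace X] {φ : X → ℝ} {γ : ℝ → X} {a m : ℝ}

theorem antitone (hγ : IsSteepDescent φ m γ) (hm : 0 ≤ m) : Antitone (φ ∘ γ) := fun _ _ hst =>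
  sub_nonneg.1 ((mul_nonneg hm dist_nonneg).trans (hγ hst))

theorem mul_dist_le_abs_sub (hγ : IsSteepDescent φ m γ) (s t : ℝ) :
    m * dist (γ s) (γ t) ≤ |φ (γ s) - φ (γ t)| := by
  rcases le_total s t with hst | hts
  · exact (hγ hst).trans (le_abs_self _)
  · rw [dist_comm, abs_sub_comm]
    exact (hγ hts).trans (le_abs_self _)

theorem mul_dist_le_of_mem_closure_range (hγ : IsSteepDescent φ m γ) (hφ : Continuous φ) {p q : X}
    (hp : p ∈ closure (range γ)) (hq : q ∈ closure (range γ)) :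
    m * dist p q ≤ |φ p - φ q| := by
  have hclosed : IsClosed {z : X × X | m * dist z.1 z.2 ≤ |φ z.1 - φ z.2|} :=
    isClosed_le (continuous_const.mul continuous_dist)
      ((hφ.comp continuous_fst).sub (hφ.comp continuous_snd)).abs
  have hsub : range γ ×ˢ range γ ⊆ {z : X × X | m * dist z.1 z.2 ≤ |φ z.1 - φ z.2|} := by
    rintro ⟨_, _⟩ ⟨⟨s, rfl⟩, t, rfl⟩
    exact hγ.mul_dist_le_abs_sub s t
  have hmem : ((p, q) : X × X) ∈ closure (range γ ×ˢ range γ) := by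
    rw [closure_prod_eq]
    exact ⟨hp, hq⟩
  exact closure_minimal hsub hclosed hmem

theorem exists_tendsto [CompleteSpace X] (hγ : IsSteepDescent φ m γ) (hm : 0 < m)
    (hbdd : BddBelow (range (φ ∘ γ))) : ∃ y, Tendsto γ atTop (𝓝 y) := by
  have hcauchy : CauchySeq (φ ∘ γ) := (tendsto_atTop_ciInf (hγ.antitone hm.le) hbdd).cauchySeq
  refine cauchySeq_tendsto_of_complete (Metric.cauchySeq_iff.2 fun δ hδ => ?_)
  obtain ⟨N, hN⟩ := Metric.cauchySeq_iff.1 hcauchy (m * δ) (mul_pos hm hδ)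
  exact ⟨N, fun s hs t ht =>
    lt_of_mul_lt_mul_left ((hγ.mul_dist_le_abs_sub s t).trans_lt (hN s hs t ht)) hm.le⟩

theorem exists_mem_closure_range_eq [CompleteSpace X] (hγ : IsSteepDescent φ m γ) (hm : 0 < m)
    (hφ : Continuous φ) (hcont : Continuous γ) (hlim : ∀ y, Tendsto γ atTop (𝓝 y) → φ y ≤ a)
    {l : ℝ} (hl : l ∈ Icc (min a (φ (γ 0))) (φ (γ 0))) :
    ∃ p ∈ closure (range γ), φ p = l := by
  by_cases hcross : ∃ t, φ (γ t) ≤ l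
  · obtain ⟨t, ht⟩ := hcross
    obtain ⟨s, hs⟩ := mem_range_of_exists_le_of_exists_ge (hφ.comp hcont) ⟨t, ht⟩ ⟨0, hl.2⟩
    exact ⟨γ s, subset_closure (mem_range_self s), hs⟩
  · push Not at hcross
    obtain ⟨y, hy⟩ := hγ.exists_tendsto hm ⟨l, forall_mem_range.2 fun t => (hcross t).le⟩
    have hly : l ≤ φ y :=
      ge_of_tendsto' ((hφ.tendsto y).comp hy) fun t => (hcross t).le
    have hal : a ≤ l := (min_le_iff.1 hl.1).resolve_right (hcross 0).not_ge
    exact ⟨y, mem_closure_of_tendsto hy (Eventually.of_forall mem_range_self),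
      ((hlim y hy).trans hal).antisymm hly⟩

theorem continuous_of_mem_closure_range [TopologicalSpace Z] {Γ : Z → ℝ → X} {p : Z → X}
    (hΓ : ∀ z, IsSteepDescent φ m (Γ z)) (hm : 0 < m) (hφ : Continuous φ)
    (hcont : ∀ t, Continuous fun z => Γ z t) (hφp : Continuous fun z => φ (p z))
    (hp : ∀ z, p z ∈ closure (range (Γ z))) : Continuous p := by
  refine continuous_iff_continuousAt.2 fun z₀ => Metric.tendsto_nhds.2 fun δ hδ => ?_
  have hnear : ∀ᶠ q in 𝓝 (p z₀), |φ (p z₀) - φ q| / m + dist q (p z₀) < δ := by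
    have : ContinuousAt (fun q => |φ (p z₀) - φ q| / m + dist q (p z₀)) (p z₀) := by fun_prop
    exact this.eventually_lt_const (by simpa using hδ)
  obtain ⟨_, ht, t, rfl⟩ := mem_closure_iff_nhds.1 (hp z₀) _ hnear
  have hnear' : ∀ᶠ z in 𝓝 z₀, |φ (p z) - φ (Γ z t)| / m + dist (Γ z t) (p z₀) < δ := by
    have hΓt := hcont t
    have : Continuous fun z => |φ (p z) - φ (Γ z t)| / m + dist (Γ z t) (p z₀) :=
      ((hφp.sub (hφ.comp hΓt)).abs.div_const m).add (hΓt.dist continuous_const)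
    exact this.continuousAt.eventually_lt_const ht
  filter_upwards [hnear'] with z hz
  have hpΓ : dist (p z) (Γ z t) ≤ |φ (p z) - φ (Γ z t)| / m := by
    rw [le_div_iff₀' hm]
    exact (hΓ z).mul_dist_le_of_mem_closure_range hφ (hp z) (subset_closure (mem_range_self t))
  linarith [dist_triangle (p z) (Γ z t) (p z₀)]

theorem exists_continuous_level_eq [CompleteSpace X] [TopologicalSpace Z]
    {Γ : Z → ℝ → X} (hΓ : ∀ z, IsSteepDescent φ m (Γ z)) (hm : 0 < m) (hφ : Continuous φ)
    (hcont : Continuous (Function.uncurry Γ))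
    (hlim : ∀ z y, Tendsto (Γ z) atTop (𝓝 y) → φ y ≤ a) {l : Z → ℝ} (hl : Continuous l)
    (hlmem : ∀ z, l z ∈ Icc (min a (φ (Γ z 0))) (φ (Γ z 0))) :
    ∃ p : Z → X, Continuous p ∧ ∀ z, p z ∈ closure (range (Γ z)) ∧ φ (p z) = l z := by
  choose p hp hpl using fun z => (hΓ z).exists_mem_closure_range_eq hm hφ
    (hcont.uncurry_left z) (hlim z) (hlmem z)
  exact ⟨p, continuous_of_mem_closure_range hΓ hm hφ (fun t => hcont.uncurry_right t)
    (hl.congr fun z => (hpl z).symm) hp, fun z => ⟨hp z, hpl z⟩⟩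

end IsSteepDescent

end SteepDescent

section Flow

variable {E : Type*} [NormedAddCommGroup E] [NormedSpace ℝ E]

theorem dist_le_of_isIntegralCurve {v : ℝ → E → E} {K : ℝ≥0} (hv : ∀ t, LipschitzWith K (v t))
    {f g : ℝ → E} (hf : IsIntegralCurve f v) (hg : IsIntegralCurve g v) {s t : ℝ} (hst : s ≤ t) :
    dist (f t) (g t) ≤ dist (f s) (g s) * Real.exp (K * (t - s)) :=
  dist_le_of_trajectories_ODE hv hf.continuous.continuousOn
    (fun τ _ => (hf τ).hasDerivWithinAt) hg.continuous.continuousOn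
    (fun τ _ => (hg τ).hasDerivWithinAt) le_rfl t (right_mem_Icc.2 hst)

theorem exists_isIntegralCurve_of_bounded [CompleteSpace E] {v : ℝ → E → E} {K C : ℝ≥0}
    (hv : ∀ t, LipschitzWith K (v t)) (hcont : ∀ x, Continuous fun t => v t x)
    (hC : ∀ t x, ‖v t x‖ ≤ C) (x : E) : ∃ γ : ℝ → E, γ 0 = x ∧ IsIntegralCurve γ v := by
  have hlocal (n : ℕ) : ∃ α : ℝ → E, α 0 = x ∧
      ∀ t ∈ Ioo (-(n + 1) : ℝ) (n + 1), HasDerivAt α (v t (α t)) t := by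
    have h0 : (0 : ℝ) ∈ Icc (-(n + 1) : ℝ) (n + 1) := ⟨by linarith, by positivity⟩
    have hPL : IsPicardLindelof v (⟨0, h0⟩ : Icc (-(n + 1) : ℝ) (n + 1)) x (C * (n + 1)) 0 C K :=
      { lipschitzOnWith := fun t _ => (hv t).lipschitzOnWith
        continuousOn := fun y _ => (hcont y).continuousOn
        norm_le := fun t _ y _ => hC t y
        mul_max_le := by simp }
    obtain ⟨α, hα0, hα⟩ := hPL.exists_eq_forall_mem_Icc_hasDerivWithinAt₀
    exact ⟨α, hα0, fun t ht =>
      (hα t (Ioo_subset_Icc_self ht)).hasDerivAt (Icc_mem_nhds ht.1 ht.2)⟩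
  choose α hα0 hα using hlocal
  have hagree {k n : ℕ} (hkn : k ≤ n) : EqOn (α k) (α n) (Ioo (-(k + 1) : ℝ) (k + 1)) := by
    have hkn' : (k : ℝ) ≤ n := by exact_mod_cast hkn
    exact ODE_solution_unique_of_mem_Ioo (s := fun _ => univ) (t₀ := 0)
      (fun t _ => (hv t).lipschitzOnWith) ⟨by linarith, by positivity⟩
      (fun t ht => ⟨hα k t ht, mem_univ _⟩)
      (fun t ht => ⟨hα n t ⟨by linarith [ht.1], by linarith [ht.2]⟩, mem_univ _⟩)
      (by rw [hα0, hα0])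
  have heq (n : ℕ) : EqOn (fun t => α ⌈|t|⌉₊ t) (α n) (Ioo (-(n + 1) : ℝ) (n + 1)) := by
    intro t ht
    rcases le_total ⌈|t|⌉₊ n with h | h
    · exact hagree h (abs_lt.1 ((Nat.le_ceil |t|).trans_lt (lt_add_one _)))
    · exact (hagree h ht).symm
  refine ⟨fun t => α ⌈|t|⌉₊ t, by simp [hα0], fun t => ?_⟩
  have ht : t ∈ Ioo (-(⌈|t|⌉₊ + 1) : ℝ) (⌈|t|⌉₊ + 1) :=
    abs_lt.1 ((Nat.le_ceil |t|).trans_lt (lt_add_one _))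
  exact (hα _ t ht).congr_of_eventuallyEq ((heq _).eventuallyEq_of_mem (Ioo_mem_nhds ht.1 ht.2))

/-- `Φ x` is the integral curve through `x`, defined for all times, of the autonomous vector
field `v`. -/
structure IsGlobalFlow (v : E → E) (Φ : E → ℝ → E) : Prop where
  map_zero : ∀ x, Φ x 0 = x
  isIntegralCurve : ∀ x, IsIntegralCurve (Φ x) fun _ => v

theorem exists_isGlobalFlow [CompleteSpace E] {v : E → E} {K C : ℝ≥0} (hv : LipschitzWith K v)
    (hC : ∀ x, ‖v x‖ ≤ C) : ∃ Φ, IsGlobalFlow v Φ := by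
  choose Φ hΦ0 hΦ using exists_isIntegralCurve_of_bounded (v := fun _ => v) (fun _ => hv)
    (fun _ => continuous_const) (fun _ => hC)
  exact ⟨Φ, hΦ0, hΦ⟩

namespace IsGlobalFlow

variable {v : E → E} {Φ : E → ℝ → E} {K C : ℝ≥0}

theorem reverse (hΦ : IsGlobalFlow v Φ) : IsGlobalFlow (-v) fun x t => Φ x (-t) where
  map_zero x := by simp [hΦ.map_zero]
  isIntegralCurve x t := by simpa [Function.comp_def] using (hΦ.isIntegralCurve x).comp_mul (-1) t

theorem lipschitzWith (hΦ : IsGlobalFlow v Φ) (hv : LipschitzWith K v) (t : ℝ) :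
    LipschitzWith (Real.toNNReal (Real.exp (K * |t|))) fun x => Φ x t := by
  wlog ht : 0 ≤ t generalizing v Φ t
  · simpa using this hΦ.reverse hv.neg (-t) (by linarith)
  refine LipschitzWith.of_dist_le_mul fun x y => ?_
  have := dist_le_of_isIntegralCurve (fun _ => hv) (hΦ.isIntegralCurve x) (hΦ.isIntegralCurve y) ht
  rw [Real.coe_toNNReal _ (Real.exp_pos _).le, abs_of_nonneg ht]
  simpa [hΦ.map_zero, mul_comm] using this

theorem map_neg_map (hΦ : IsGlobalFlow v Φ) (hv : LipschitzWith K v) (x : E) (t : ℝ) :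
    Φ (Φ x t) (-t) = x := by
  have hshift : IsIntegralCurve (fun τ => Φ x (τ + t)) fun _ => v :=
    (hΦ.isIntegralCurve x).comp_add t
  have := ODE_solution_unique_univ (s := fun _ => univ) (t₀ := 0) (v := fun _ => v)
    (fun _ => hv.lipschitzOnWith) (fun τ => ⟨hΦ.isIntegralCurve (Φ x t) τ, mem_univ _⟩)
    (fun τ => ⟨hshift τ, mem_univ _⟩) (by simp [hΦ.map_zero])
  simpa [hΦ.map_zero] using congrFun this (-t)

theorem antilipschitzWith (hΦ : IsGlobalFlow v Φ) (hv : LipschitzWith K v) (t : ℝ) :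
    AntilipschitzWith (Real.toNNReal (Real.exp (K * |t|))) fun x => Φ x t := by
  simpa using (hΦ.lipschitzWith hv (-t)).to_rightInverse fun x => hΦ.map_neg_map hv x t

theorem continuous_uncurry (hΦ : IsGlobalFlow v Φ) (hv : LipschitzWith K v)
    (hC : ∀ x, ‖v x‖ ≤ C) : Continuous (Function.uncurry Φ) :=
  continuous_prod_of_continuous_lipschitzWith' _ C
    (fun x => lipschitzWith_of_nnnorm_deriv_le
      (fun t => (hΦ.isIntegralCurve x t).differentiableAt)
      (fun t => (congrArg nnnorm (hΦ.isIntegralCurve x t).deriv).trans_le (hC _)))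
    (fun t => (hΦ.lipschitzWith hv t).continuous)

end IsGlobalFlow
end Flow

section Rademacher

variable {E : Type*} [NormedAddCommGroup E] [NormedSpace ℝ E] [FiniteDimensional ℝ E]
  [MeasurableSpace E] [BorelSpace E] (μ : Measure E) [μ.IsAddHaarMeasure]

theorem ae_differentiableAt_of_locallyLipschitz {F : Type*} [NormedAddCommGroup F]
    [NormedSpace ℝ F] [FiniteDimensional ℝ F] {f : E → F} (hf : LocallyLipschitz f) :
    ∀ᵐ x ∂μ, DifferentiableAt ℝ f x := by
  refine measure_null_of_locally_null _ fun x _ => ?_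
  obtain ⟨K, u, hu, hK⟩ := hf x
  have hint : ∀ᵐ z ∂μ, z ∈ interior u → DifferentiableAt ℝ f z := by
    filter_upwards [hK.ae_differentiableWithinAt_of_mem (μ := μ)] with z hz hzu
    exact (hz (interior_subset hzu)).differentiableAt (mem_interior_iff_mem_nhds.1 hzu)
  refine ⟨{z | ¬DifferentiableAt ℝ f z} ∩ interior u,
    inter_mem_nhdsWithin _ (interior_mem_nhds.2 hu), measure_mono_null ?_ (ae_iff.1 hint)⟩
  exact fun z hz hzu => hz.1 (hzu hz.2)

theorem quasiMeasurePreserving_of_antilipschitzWith {K : ℝ≥0} {f : E → E} (hf : Measurable f)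
    (hK : AntilipschitzWith K f) : Measure.QuasiMeasurePreserving f μ μ := by
  let ν : Measure E := μH[Module.finrank ℝ E]
  have hμν : μ ≪ ν := Measure.absolutelyContinuous_isAddHaarMeasure μ ν
  have hνμ : ν ≪ μ := Measure.absolutelyContinuous_isAddHaarMeasure ν μ
  refine ⟨hf, Measure.AbsolutelyContinuous.mk fun s hs hμs => ?_⟩
  rw [Measure.map_apply hf hs]
  refine hμν (le_antisymm ?_ zero_le)
  calc ν (f ⁻¹' s) ≤ K ^ (Module.finrank ℝ E : ℝ) * ν s :=
        hK.hausdorffMeasure_preimage_le (Nat.cast_nonneg _) s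
    _ = 0 := by rw [hνμ hμs, mul_zero]

theorem IsGlobalFlow.ae_ae {v : E → E} {Φ : E → ℝ → E} {K C : ℝ≥0} (hΦ : IsGlobalFlow v Φ)
    (hv : LipschitzWith K v) (hC : ∀ x, ‖v x‖ ≤ C) {p : E → Prop} (hp : ∀ᵐ x ∂μ, p x) :
    ∀ᵐ x ∂μ, ∀ᵐ t : ℝ, p (Φ x t) := by
  have hquasi : Measure.QuasiMeasurePreserving (Function.uncurry Φ) (μ.prod volume) μ :=
    QuasiMeasurePreserving.prod_of_left (hΦ.continuous_uncurry hv hC).measurable <|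
      Eventually.of_forall fun t => quasiMeasurePreserving_of_antilipschitzWith μ
        (hΦ.lipschitzWith hv t).continuous.measurable (hΦ.antilipschitzWith hv t)
  exact Measure.ae_ae_of_ae_prod (hquasi.ae hp)

end Rademacher

section PseudoGradient

/-- `X` is a pseudo-gradient field of `φ`: wherever `φ` is differentiable it grows in the direction
`X`, at rate at least `m * σ`, where `σ` bounds the norm of `X`. -/
structure IsPseudoGradient {E : Type*} [NormedAddCommGroup E] [NormedSpace ℝ E] (φ : E → ℝ)
    (m : ℝ) (σ : E → ℝ) (X : E → E) : Prop where
  norm_le : ∀ z, ‖X z‖ ≤ σ z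
  le_fderiv : ∀ z, DifferentiableAt ℝ φ z → m * σ z ≤ fderiv ℝ φ z (X z)

namespace IsPseudoGradient

variable {E : Type*} [NormedAddCommGroup E] [NormedSpace ℝ E] {φ σ : E → ℝ} {m : ℝ} {X : E → E}
  {γ : ℝ → E} {s t : ℝ}

theorem dist_le_integral [CompleteSpace E] (hX : IsPseudoGradient φ m σ X) (hXc : Continuous X)
    (hσ : Continuous σ) (hγ : IsIntegralCurve γ fun _ => -X) (hst : s ≤ t) :
    dist (γ s) (γ t) ≤ ∫ τ in s..t, σ (γ τ) := by
  have hFTC : ∫ τ in s..t, -X (γ τ) = γ t - γ s :=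
    intervalIntegral.integral_eq_sub_of_hasDerivAt (fun τ _ => hγ τ)
      ((hXc.comp hγ.continuous).neg.intervalIntegrable s t)
  rw [dist_comm, dist_eq_norm, ← hFTC]
  exact intervalIntegral.norm_integral_le_of_norm_le hst
    (Eventually.of_forall fun τ _ => (norm_neg _).trans_le (hX.norm_le _))
    ((hσ.comp hγ.continuous).intervalIntegrable s t)

theorem mul_integral_le_sub_of_ae_differentiableAt (hX : IsPseudoGradient φ m σ X)
    (hXc : Continuous X) (hσ : Continuous σ) (hφ : LocallyLipschitz φ)
    (hγ : IsIntegralCurve γ fun _ => -X) (hdiff : ∀ᵐ τ, DifferentiableAt ℝ φ (γ τ))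
    (hst : s ≤ t) : m * ∫ τ in s..t, σ (γ τ) ≤ φ (γ s) - φ (γ t) := by
  have hγ1 : ContDiff ℝ 1 γ := contDiff_one_iff_deriv.2
    ⟨fun τ => (hγ τ).differentiableAt,
      (hXc.neg.comp hγ.continuous).congr fun τ => (hγ τ).deriv.symm⟩
  obtain ⟨L, hL⟩ := (hφ.comp hγ1.locallyLipschitz).locallyLipschitzOn
    |>.exists_lipschitzOnWith_of_compact (isCompact_uIcc (a := s) (b := t))
  have hAC : AbsolutelyContinuousOnInterval (φ ∘ γ) s t := hL.absolutelyContinuousOnInterval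
  calc m * ∫ τ in s..t, σ (γ τ)
      = ∫ τ in s..t, m * σ (γ τ) := (intervalIntegral.integral_const_mul _ _).symm
    _ ≤ ∫ τ in s..t, -deriv (φ ∘ γ) τ := by
      refine intervalIntegral.integral_mono_ae hst
        ((hσ.comp hγ.continuous).const_mul m |>.intervalIntegrable s t)
        hAC.intervalIntegrable_deriv.neg (hdiff.mono fun τ hτ => ?_)
      have hderiv : deriv (φ ∘ γ) τ = -fderiv ℝ φ (γ τ) (X (γ τ)) := by
        simpa using (hτ.hasFDerivAt.comp_hasDerivAt τ (hγ τ)).deriv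
      simpa only [hderiv, neg_neg] using hX.le_fderiv (γ τ) hτ
    _ = φ (γ s) - φ (γ t) := by
      rw [intervalIntegral.integral_neg, hAC.integral_deriv_eq_sub, neg_sub, Function.comp_apply,
        Function.comp_apply]

section Flow

variable [FiniteDimensional ℝ E] {K C : ℝ≥0} {Φ : E → ℝ → E}

theorem mul_integral_le_sub (hX : IsPseudoGradient φ m σ X) (hXK : LipschitzWith K X)
    (hXC : ∀ z, ‖X z‖ ≤ C) (hσ : Continuous σ) (hφ : LocallyLipschitz φ)
    (hΦ : IsGlobalFlow (-X) Φ) (hst : s ≤ t) (x : E) :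
    m * ∫ τ in s..t, σ (Φ x τ) ≤ φ (Φ x s) - φ (Φ x t) := by
  borelize E
  have hae : ∀ᵐ x ∂(Measure.addHaar : Measure E), ∀ᵐ τ, DifferentiableAt ℝ φ (Φ x τ) :=
    hΦ.ae_ae _ hXK.neg (fun z => (norm_neg _).trans_le (hXC z))
      (ae_differentiableAt_of_locallyLipschitz _ hφ)
  have hdense : Dense {x | m * ∫ τ in s..t, σ (Φ x τ) ≤ φ (Φ x s) - φ (Φ x t)} :=
    (Measure.dense_of_ae hae).mono fun x hx =>
      hX.mul_integral_le_sub_of_ae_differentiableAt hXK.continuous hσ hφ (hΦ.isIntegralCurve x)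
        hx hst
  have hΦc : Continuous (Function.uncurry Φ) :=
    hΦ.continuous_uncurry hXK.neg fun z => (norm_neg _).trans_le (hXC z)
  have hΦt (τ : ℝ) : Continuous fun x => φ (Φ x τ) := hφ.continuous.comp (hΦc.uncurry_right τ)
  have hclosed : IsClosed {x | m * ∫ τ in s..t, σ (Φ x τ) ≤ φ (Φ x s) - φ (Φ x t)} :=
    isClosed_le (continuous_const.mul
      (intervalIntegral.continuous_parametric_intervalIntegral_of_continuous'
        (f := fun x τ => σ (Φ x τ)) (hσ.comp hΦc) s t))
      ((hΦt s).sub (hΦt t))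
  exact hclosed.closure_subset (hdense x)

theorem isSteepDescent_flow (hX : IsPseudoGradient φ m σ X) (hXK : LipschitzWith K X)
    (hXC : ∀ z, ‖X z‖ ≤ C) (hσ : Continuous σ) (hφ : LocallyLipschitz φ) (hm : 0 ≤ m)
    (hΦ : IsGlobalFlow (-X) Φ) (x : E) : IsSteepDescent φ m (Φ x) := fun _ _ hst =>
  (mul_le_mul_of_nonneg_left
    (hX.dist_le_integral hXK.continuous hσ (hΦ.isIntegralCurve x) hst) hm).trans
    (hX.mul_integral_le_sub hXK hXC hσ hφ hΦ hst x)

theorem nonpos_of_tendsto_flow (hX : IsPseudoGradient φ m σ X) (hXK : LipschitzWith K X)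
    (hXC : ∀ z, ‖X z‖ ≤ C) (hσ : Continuous σ) (hφ : LocallyLipschitz φ) (hm : 0 < m)
    (hΦ : IsGlobalFlow (-X) Φ) {x y : E} (hy : Tendsto (Φ x) atTop (𝓝 y)) : σ y ≤ 0 := by
  by_contra! hσy
  obtain ⟨T, hT⟩ : ∃ T, ∀ τ ≥ T, σ y / 2 ≤ σ (Φ x τ) :=
    eventually_atTop.1 <| ((hσ.tendsto y).comp hy).eventually_const_le (half_lt_self hσy)
  have hle (t : ℝ) (ht : T ≤ t) : m * (σ y / 2) ≤ φ (Φ x t) - φ (Φ x (t + 1)) :=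
    calc m * (σ y / 2) = m * ∫ _ in t..t + 1, σ y / 2 := by simp
      _ ≤ m * ∫ τ in t..t + 1, σ (Φ x τ) := by
        refine mul_le_mul_of_nonneg_left ?_ hm.le
        exact intervalIntegral.integral_mono_on (by linarith) intervalIntegrable_const
          ((hσ.comp (hΦ.isIntegralCurve x).continuous).intervalIntegrable _ _)
          fun τ hτ => hT τ (ht.trans hτ.1)
      _ ≤ φ (Φ x t) - φ (Φ x (t + 1)) :=
        hX.mul_integral_le_sub hXK hXC hσ hφ hΦ (by linarith) x
  have hφy : Tendsto (fun t => φ (Φ x t)) atTop (𝓝 (φ y)) := (hφ.continuous.tendsto y).comp hy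
  have hlim : Tendsto (fun t => φ (Φ x t) - φ (Φ x (t + 1))) atTop (𝓝 0) := by
    simpa using hφy.sub (hφy.comp (tendsto_atTop_add_const_right atTop 1 tendsto_id))
  exact (ge_of_tendsto hlim ((eventually_ge_atTop T).mono hle)).not_gt (mul_pos hm (half_pos hσy))

end Flow

end IsPseudoGradient

end PseudoGradient
section Gluing

theorem exists_lipschitzWith_one_pos {X : Type*} [PseudoMetricSpace X] {x : X} {U : Set X}
    (hU : U ∈ 𝓝 x) :
    ∃ f : X → ℝ, LipschitzWith 1 f ∧ (∀ z, f z ∈ Icc 0 1) ∧ (∀ z ∉ U, f z = 0) ∧ 0 < f x := by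
  obtain ⟨r, hr, hrU⟩ := Metric.mem_nhds_iff.1 hU
  have hdist : LipschitzWith 1 fun z => r - dist z x :=
    LipschitzWith.of_dist_le_mul fun z z' => by
      rw [Real.dist_eq, NNReal.coe_one, one_mul, sub_sub_sub_cancel_left, abs_sub_comm]
      exact abs_dist_sub_le _ _ _
  refine ⟨fun z => min 1 (max 0 (r - dist z x)), (hdist.const_max 0).const_min 1,
    fun z => ⟨by positivity, min_le_left _ _⟩, fun z hz => ?_, by simpa using hr⟩
  have hrz : r ≤ dist z x := not_lt.1 fun h => hz (hrU h)
  simp [hrz]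

theorem exists_summable_lipschitzWith_weights {X : Type*} [PseudoMetricSpace X]
    [SecondCountableTopology X] {S : Set X} {U : X → Set X} (hU : ∀ x ∈ S, U x ∈ 𝓝 x) :
    ∃ t ⊆ S, ∃ (c : t → ℝ≥0) (ρ : t → X → ℝ), Summable c ∧ (∀ i, LipschitzWith (c i) (ρ i)) ∧
      (∀ i z, ρ i z ∈ Icc 0 (c i : ℝ)) ∧ (∀ i : t, ∀ z ∉ U i, ρ i z = 0) ∧
      ∀ x ∈ S, ∃ i, 0 < ρ i x := by
  choose! f hf hf01 hf0 hfx using fun x (hx : x ∈ S) => exists_lipschitzWith_one_pos (hU x hx)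
  obtain ⟨t, htS, ht, hcover⟩ := TopologicalSpace.countable_cover_nhdsWithin
    (f := fun x => {z | 0 < f x z}) fun x hx => mem_nhdsWithin_of_mem_nhds <|
      (hf x hx).continuous.continuousAt.eventually_const_lt (hfx x hx)
  have := ht.to_subtype
  obtain ⟨c, hc0, C, hcC, -⟩ := NNReal.exists_pos_sum_of_countable one_ne_zero t
  refine ⟨t, htS, c, fun i z => c i * f i z, hcC.summable, fun i => ?_, fun i z => ?_,
    fun i z hz => ?_, fun x hx => ?_⟩
  · simpa [Function.comp_def] using (lipschitzWith_smul (c i : ℝ)).comp (hf i (htS i.2))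
  · have hfiz := hf01 i (htS i.2) z
    exact ⟨mul_nonneg (c i).2 hfiz.1, mul_le_of_le_one_right (c i).2 hfiz.2⟩
  · exact mul_eq_zero_of_right _ (hf0 i (htS i.2) z hz)
  · obtain ⟨y, hy, hyx⟩ := mem_iUnion₂.1 (hcover hx)
    exact ⟨⟨y, hy⟩, mul_pos (hc0 _) hyx⟩

theorem lipschitzWith_tsum {ι X F : Type*} [PseudoMetricSpace X] [NormedAddCommGroup F]
    {f : ι → X → F} {K : ι → ℝ≥0} (hK : Summable K) (hf : ∀ i, LipschitzWith (K i) (f i))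
    (hsum : ∀ x, Summable fun i => f i x) :
    LipschitzWith (∑' i, K i) fun x => ∑' i, f i x := by
  refine LipschitzWith.of_dist_le_mul fun x y => ?_
  rw [dist_eq_norm, ← (hsum x).tsum_sub (hsum y)]
  refine tsum_of_norm_bounded ((NNReal.hasSum_coe.2 hK.hasSum).mul_right (dist x y)) fun i => ?_
  rw [← dist_eq_norm]
  exact (hf i).dist_le_mul x y

variable {E : Type*} [NormedAddCommGroup E] [NormedSpace ℝ E] {φ : E → ℝ} {m : ℝ}

theorem norm_smul_le_abs_of_norm_le_one {w : E} (hw : ‖w‖ ≤ 1) (r : ℝ) : ‖r • w‖ ≤ |r| :=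
  (norm_smul_le r w).trans (mul_le_of_le_one_right (abs_nonneg r) hw)

theorem isPseudoGradient_tsum [CompleteSpace E] {ι : Type*} {ρ : ι → E → ℝ} {w : ι → E}
    (hρ : ∀ i z, 0 ≤ ρ i z) (hsum : ∀ z, Summable fun i => ρ i z) (hw : ∀ i, ‖w i‖ ≤ 1)
    (hφ : ∀ i z, ρ i z ≠ 0 → DifferentiableAt ℝ φ z → m ≤ fderiv ℝ φ z (w i)) :
    IsPseudoGradient φ m (fun z => ∑' i, ρ i z) (fun z => ∑' i, ρ i z • w i) := by
  have hnorm (i : ι) (z : E) : ‖ρ i z • w i‖ ≤ ρ i z :=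
    (norm_smul_le_abs_of_norm_le_one (hw i) _).trans_eq (abs_of_nonneg (hρ i z))
  refine ⟨fun z => tsum_of_norm_bounded (hsum z).hasSum fun i => hnorm i z, fun z hz => ?_⟩
  have hXsum := ((hsum z).of_norm_bounded fun i => hnorm i z).hasSum.mapL (fderiv ℝ φ z)
  refine hasSum_le (fun i => ?_) ((hsum z).hasSum.mul_left m) hXsum
  rw [map_smul, smul_eq_mul, mul_comm]
  by_cases hi : ρ i z = 0
  · simp [hi]
  · exact mul_le_mul_of_nonneg_left (hφ i z hi hz) (hρ i z)

theorem exists_isPseudoGradient [CompleteSpace E] [SecondCountableTopology E] {S : Set E}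
    (h : ∀ x ∈ S, ∃ w : E, ‖w‖ ≤ 1 ∧
      ∀ᶠ z in 𝓝 x, DifferentiableAt ℝ φ z → m ≤ fderiv ℝ φ z w) :
    ∃ (K C : ℝ≥0) (σ : E → ℝ) (X : E → E), LipschitzWith K X ∧ Continuous σ ∧ (∀ z, σ z ≤ C) ∧
      (∀ z ∈ S, 0 < σ z) ∧ IsPseudoGradient φ m σ X := by
  choose! w hw hφ using h
  obtain ⟨t, htS, c, ρ, hc, hρ, hρc, hρ0, hρS⟩ := exists_summable_lipschitzWith_weights hφ
  have hw' (i : t) : ‖w i‖ ≤ 1 := hw i (htS i.2)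
  have hρsum (z : E) : Summable fun i => ρ i z :=
    (NNReal.summable_coe.2 hc).of_nonneg_of_le (fun i => (hρc i z).1) fun i => (hρc i z).2
  have hXsum (z : E) : Summable fun i => ρ i z • w i :=
    (hρsum z).abs.of_norm_bounded fun i => norm_smul_le_abs_of_norm_le_one (hw' i) _
  have hXLip (i : t) : LipschitzWith (c i) fun z => ρ i z • w i :=
    LipschitzWith.of_dist_le_mul fun y z => by
      rw [dist_eq_norm, ← sub_smul]
      exact (norm_smul_le_abs_of_norm_le_one (hw' i) _).trans ((hρ i).dist_le_mul y z)
  refine ⟨∑' i, c i, ∑' i, c i, fun z => ∑' i, ρ i z, fun z => ∑' i, ρ i z • w i,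
    lipschitzWith_tsum hc hXLip hXsum, (lipschitzWith_tsum hc hρ hρsum).continuous, fun z => ?_,
    fun z hz => ?_, isPseudoGradient_tsum (fun i z => (hρc i z).1) hρsum hw' fun i z hi => ?_⟩
  · exact hasSum_le (fun i => (hρc i z).2) (hρsum z).hasSum (NNReal.hasSum_coe.2 hc.hasSum)
  · obtain ⟨i, hi⟩ := hρS z hz
    exact (hρsum z).tsum_pos (fun i => (hρc i z).1) i hi
  · by_contra hz
    exact hi (hρ0 i z hz)

end Gluing

section Clarke

theorem exists_norm_le_one_forall_infDist_le_inner {E : Type*} [NormedAddCommGroup E]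
    [InnerProductSpace ℝ E] [CompleteSpace E] {A : Set E} (hA : Convex ℝ A) :
    ∃ w : E, ‖w‖ ≤ 1 ∧ ∀ v ∈ A, infDist 0 A ≤ inner ℝ w v := by
  rcases A.eq_empty_or_nonempty with rfl | hne
  · exact ⟨0, by simp, by simp⟩
  obtain ⟨p, hp, hpmin⟩ := exists_norm_eq_iInf_of_complete_convex hne.closure
    isClosed_closure.isComplete hA.closure 0
  rw [norm_eq_iInf_iff_real_inner_le_zero hA.closure hp] at hpmin
  have hdist : infDist 0 A ≤ ‖p‖ := by
    simpa [infDist_closure] using infDist_le_dist_of_mem (x := (0 : E)) hp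
  refine ⟨‖p‖⁻¹ • p, ?_, fun v hv => hdist.trans ?_⟩
  · rw [norm_smul, norm_inv, norm_norm]
    exact inv_mul_le_one
  have hpv : ‖p‖ * ‖p‖ ≤ inner ℝ p v := by
    have := hpmin v (subset_closure hv)
    rw [zero_sub, inner_neg_left, inner_sub_right, real_inner_self_eq_norm_mul_norm] at this
    linarith
  rw [real_inner_smul_left, inv_mul_eq_div]
  rcases (norm_nonneg p).eq_or_lt with hp0 | hp0
  · simp [← hp0]
  · rwa [le_div_iff₀ hp0]

variable {d : ℕ} {φ : EuclideanSpace ℝ (Fin d) → ℝ} {x : EuclideanSpace ℝ (Fin d)} {m : ℝ}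

theorem eventually_lt_fderiv_of_forall_clarkeGradient (hφ : LocallyLipschitz φ)
    {w : EuclideanSpace ℝ (Fin d)} (h : ∀ v ∈ clarkeGradient φ x, m < inner ℝ w v) :
    ∀ᶠ z in 𝓝 x, DifferentiableAt ℝ φ z → m < fderiv ℝ φ z w := by
  by_contra hcon
  obtain ⟨u, hux, hu⟩ := exists_seq_forall_of_frequently (not_eventually.1 hcon)
  push Not at hu
  obtain ⟨K, U, hU, hK⟩ := hφ x
  have hbdd : ∀ᶠ n in atTop, gradient φ (u n) ∈ closedBall 0 (K : ℝ) := by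
    filter_upwards [hux.eventually (eventually_mem_nhds_iff.2 hU)] with n hn
    rw [mem_closedBall_zero_iff, gradient, LinearIsometryEquiv.norm_map]
    exact norm_fderiv_le_of_lipschitzOn ℝ hn hK
  obtain ⟨v, -, θ, hθ, hv⟩ := (isCompact_closedBall _ _).tendsto_subseq' hbdd.frequently
  have hvx : v ∈ clarkeGradient φ x := subset_convexHull ℝ _
    ⟨u ∘ θ, fun n => (hu _).1, hux.comp hθ.tendsto_atTop, hv⟩
  refine (h v hvx).not_ge (le_of_tendsto' (tendsto_const_nhds.inner hv) fun n => ?_)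
  rw [real_inner_comm, Function.comp_apply, inner_gradient_left]
  exact (hu _).2

theorem exists_norm_le_one_eventually_lt_fderiv (hφ : LocallyLipschitz φ)
    (h : m < distZero (clarkeGradient φ x)) : ∃ w : EuclideanSpace ℝ (Fin d), ‖w‖ ≤ 1 ∧
      ∀ᶠ z in 𝓝 x, DifferentiableAt ℝ φ z → m < fderiv ℝ φ z w := by
  obtain ⟨w, hw, hmw⟩ := exists_norm_le_one_forall_infDist_le_inner
    (convex_convexHull ℝ _ : Convex ℝ (clarkeGradient φ x))
  exact ⟨w, hw, eventually_lt_fderiv_of_forall_clarkeGradient hφ fun v hv => h.trans_le (hmw v hv)⟩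

end Clarke

section LevelFlow

variable {E : Type*} [NormedAddCommGroup E] [NormedSpace ℝ E] [FiniteDimensional ℝ E]
  {φ : E → ℝ} {a b m : ℝ}

theorem exists_steepDescent_flow {S : Set E} (hφ : LocallyLipschitz φ) (hm : 0 < m)
    (h : ∀ x ∈ S, ∃ w : E, ‖w‖ ≤ 1 ∧
      ∀ᶠ z in 𝓝 x, DifferentiableAt ℝ φ z → m ≤ fderiv ℝ φ z w) :
    ∃ Φ : E → ℝ → E, (∀ x, Φ x 0 = x) ∧ Continuous (Function.uncurry Φ) ∧
      (∀ x, IsSteepDescent φ m (Φ x)) ∧ ∀ x y, Tendsto (Φ x) atTop (𝓝 y) → y ∉ S := by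
  have := FiniteDimensional.complete ℝ E
  have := FiniteDimensional.proper ℝ E
  obtain ⟨K, C, σ, X, hXK, hσ, hσC, hσS, hX⟩ := exists_isPseudoGradient h
  have hXC (z : E) : ‖X z‖ ≤ C := (hX.norm_le z).trans (hσC z)
  have hXC' (z : E) : ‖(-X) z‖ ≤ C := (norm_neg _).trans_le (hXC z)
  obtain ⟨Φ, hΦ⟩ := exists_isGlobalFlow hXK.neg hXC'
  exact ⟨Φ, hΦ.map_zero, hΦ.continuous_uncurry hXK.neg hXC',
    hX.isSteepDescent_flow hXK hXC hσ hφ hm.le hΦ, fun x y hy hyS =>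
      (hX.nonpos_of_tendsto_flow hXK hXC hσ hφ hm hΦ hy).not_gt (hσS y hyS)⟩

theorem exists_continuousMap_level_eq_descentLevel (hab : a ≤ b) (hφ : LocallyLipschitz φ)
    (hm : 0 < m)
    (h : ∀ x ∈ φ ⁻¹' Ioc a b, ∃ w : E, ‖w‖ ≤ 1 ∧
      ∀ᶠ z in 𝓝 x, DifferentiableAt ℝ φ z → m ≤ fderiv ℝ φ z w) :
    ∃ C : C(unitInterval × φ ⁻¹' Iic b, φ ⁻¹' Iic b), (∀ x, C (0, x) = x) ∧
      (∀ t x, φ (C (t, x)) = descentLevel a b t (φ x)) ∧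
      ∀ s t x, m * dist (C (s, x)) (C (t, x)) ≤ |φ (C (s, x)) - φ (C (t, x))| := by
  obtain ⟨Φ, hΦ0, hΦc, hΦ, hlim⟩ := exists_steepDescent_flow hφ hm h
  have hlim' (x : φ ⁻¹' Iic b) (y : E) (hy : Tendsto (Φ x) atTop (𝓝 y)) : φ y ≤ a := by
    have hyx : φ y ≤ φ (Φ x 0) :=
      ((hΦ x).antitone hm.le).le_of_tendsto ((hφ.continuous.tendsto y).comp hy) 0
    rw [hΦ0] at hyx
    exact not_lt.1 fun hay => hlim x y hy ⟨hay, hyx.trans x.2⟩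
  obtain ⟨p, hp, hpmem⟩ := IsSteepDescent.exists_continuous_level_eq
    (Γ := fun z : unitInterval × φ ⁻¹' Iic b => Φ z.2) (l := fun z => descentLevel a b z.1 (φ z.2))
    (fun z => hΦ z.2) hm hφ.continuous (by fun_prop) (fun z => hlim' z.2)
    (by have := hφ.continuous; unfold descentLevel; fun_prop)
    (fun z => by simpa only [hΦ0] using descentLevel_mem_Icc hab z.1.2.1)
  have hdist (z : unitInterval × φ ⁻¹' Iic b) {q : E} (hq : q ∈ closure (range (Φ z.2))) :
      m * dist (p z) q ≤ |φ (p z) - φ q| :=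
    (hΦ z.2).mul_dist_le_of_mem_closure_range hφ.continuous (hpmem z).1 hq
  have hpb (z : unitInterval × φ ⁻¹' Iic b) : p z ∈ φ ⁻¹' Iic b :=
    (hpmem z).2.trans_le ((descentLevel_mem_Icc hab z.1.2.1).2.trans z.2.2)
  refine ⟨⟨fun z => ⟨p z, hpb z⟩, hp.subtype_mk hpb⟩, fun x => Subtype.ext (dist_le_zero.1 ?_),
    fun t x => (hpmem (t, x)).2, fun s t x => hdist (s, x) (hpmem (t, x)).1⟩
  have hlevel₀ : φ (p (0, x)) = φ x := (hpmem (0, x)).2.trans (descentLevel_zero _ _ _)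
  have := hdist (0, x) (subset_closure ⟨0, hΦ0 x⟩)
  rw [hlevel₀, sub_self, abs_zero] at this
  exact nonpos_of_mul_nonpos_right this hm

end LevelFlow

end ApproxFlow

open ApproxFlow in
theorem mainTheorem5_general (d : ℕ) (a b : ℝ) (hab : a < b)
    (φ : EuclideanSpace ℝ (Fin d) → ℝ) (hφ : LocallyLipschitz φ) (m : ℝ) (hm : 0 < m)
    (hclarke : ∀ x ∈ φ ⁻¹' Ioc a b, m < distZero (clarkeGradient φ x)) :
    ∃ C : C(unitInterval × ↥(φ ⁻¹' Iic b), ↥(φ ⁻¹' Iic b)),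
      (∀ (s t : unitInterval) (x : ↥(φ ⁻¹' Iic b)), t < s →
        (C (s, x) : EuclideanSpace ℝ (Fin d)) ∈ φ ⁻¹' Ioc a b →
        φ (C (s, x)) - φ (C (t, x)) ≤ -((s : ℝ) - (t : ℝ)) * (b - a)) ∧
      (∀ (t : unitInterval) (x : ↥(φ ⁻¹' Iic b)), φ x ≤ a → C (t, x) = x) ∧
      (∀ x : ↥(φ ⁻¹' Iic b),
        LipschitzWith (Real.toNNReal ((b - a) / m)) (fun s => C (s, x))) ∧
      IsStrongDeformationRetraction {x : ↥(φ ⁻¹' Iic b) | φ x ≤ a} C := by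
  obtain ⟨C, hC0, hlevel, hdist⟩ := exists_continuousMap_level_eq_descentLevel hab.le hφ hm
    fun x hx => (exists_norm_le_one_eventually_lt_fderiv hφ (hclarke x hx)).imp fun w hw =>
      ⟨hw.1, hw.2.mono fun z hz hφz => (hz hφz).le⟩
  have hlip (s t : unitInterval) (x) : dist (C (s, x)) (C (t, x)) ≤ (b - a) / m * dist s t := by
    rw [div_mul_eq_mul_div, le_div_iff₀' hm]
    refine (hdist s t x).trans ?_
    rw [hlevel, hlevel]
    exact abs_descentLevel_sub_le hab.le
  have hfix (t : unitInterval) (x : φ ⁻¹' Iic b) (hx : φ x ≤ a) : C (t, x) = x := by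
    have := hdist t 0 x
    rw [hC0, hlevel, descentLevel_of_le hab.le t.2.1 hx, sub_self, abs_zero] at this
    exact dist_le_zero.1 (nonpos_of_mul_nonpos_right this hm)
  refine ⟨C, fun s t x _ hs => ?_, hfix, fun x => LipschitzWith.of_dist_le_mul fun s t => ?_,
    ⟨hC0, fun x => (hlevel 1 x).trans_le (descentLevel_one_le x.2), hfix⟩⟩
  · rw [hlevel, hlevel]
    exact descentLevel_sub_le (hs.1.trans_eq (hlevel s x))
  · rw [Real.coe_toNNReal _ (div_pos (sub_pos.2 hab) hm).le]
    exact hlip s t x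

theorem mainTheorem5 (d : ℕ) (a b : ℝ) (hab : a < b)
    (φ : EuclideanSpace ℝ (Fin d) → ℝ) (hφ : LocallyLipschitz φ)
    (hφ' : ∃ k : NNReal, LipschitzOnWith k φ (closure (φ ⁻¹' Set.Ioc a b)))
    (μ : ℝ) (hμ : 0 < μ)
    (hclarke : ∀ x ∈ φ ⁻¹' Set.Ioc a b,
      μ ≤ ApproxFlow.distZero (ApproxFlow.clarkeGradient φ x))
    (ε : ℝ) (hε : 0 < ε) (hεμ : ε < μ) :
    ∃ C : C(unitInterval × ↥(φ ⁻¹' Set.Iic b), ↥(φ ⁻¹' Set.Iic b)),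
      (∀ (s t : unitInterval) (x : ↥(φ ⁻¹' Set.Iic b)), t < s →
        (C (s, x) : EuclideanSpace ℝ (Fin d)) ∈ φ ⁻¹' Set.Ioc a b →
        φ (C (s, x)) - φ (C (t, x)) ≤ -((s : ℝ) - (t : ℝ)) * (b - a)) ∧
      (∀ (t : unitInterval) (x : ↥(φ ⁻¹' Set.Iic b)), φ x ≤ a → C (t, x) = x) ∧
      (∀ x : ↥(φ ⁻¹' Set.Iic b),
        LipschitzWith (Real.toNNReal ((b - a) / (μ - ε))) (fun s => C (s, x))) ∧
      ApproxFlow.IsStrongDeformationRetraction {x : ↥(φ ⁻¹' Set.Iic b) | φ x ≤ a} C :=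
  mainTheorem5_general d a b hab φ hφ (μ - ε) (sub_pos.2 hεμ) fun x hx =>
    (sub_lt_self μ hε).trans_le (hclarke x hx)
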